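/- Let $\Gamma=(V,E)$ be a finite simple graph, and let $$G=\langle\, v\in V \mid v^2=1 \text{ for all } v\in V,\ [u,v]=1 \text{ whenever } \{u,v\}\in E \,\rangle$$ be the right-angled Coxeter group with defining graph $\Gamma$. Suppose that $G$ is infinite. For $l\ge 0$ let $a_l$ be the number of elements of $G$ of word-length $l$ with respect to the standard generating set given by $V$, and let $\alpha(G)=\limsup_{l\to\infty}\sqrt[l]{a_l}$ be the spherical exponential growth rate of $G$. Then $\alpha(G)$ is either $1$ or a Perron number, that is, a real algebraic integer greater than $1$ that is strictly greater than the absolute value of each of its other Galois conjugates. -/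

import Mathlib

open Filter

/-- The relators `v ^ 2` (for every vertex `v`) and `[u, v] = u v u⁻¹ v⁻¹` (for every edge `uv`) of the
right-angled Coxeter group with defining graph `Γ`. -/
def racgRelators {V : Type*} (Γ : SimpleGraph V) : Set (FreeGroup V) :=
  {r | ∃ v : V, r = FreeGroup.of v ^ 2} ∪
    {r | ∃ u v : V, Γ.Adj u v ∧
      r = FreeGroup.of u * FreeGroup.of v * (FreeGroup.of u)⁻¹ * (FreeGroup.of v)⁻¹}

/-- The right-angled Coxeter group with defining graph `Γ`. -/
abbrev RACG {V : Type*} (Γ : SimpleGraph V) : Type _ :=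
  PresentedGroup (racgRelators Γ)

/-- The standard generating set of the right-angled Coxeter group: the images of the vertices. -/
def racgGenerators {V : Type*} (Γ : SimpleGraph V) : Set (RACG Γ) :=
  Set.range (fun v : V => (PresentedGroup.of v : RACG Γ))

/-- `HasWordLength S g l`: the minimum length of a word over the alphabet `S ∪ S⁻¹`
whose product is `g` exists and equals `l`. -/
def HasWordLength {G : Type*} [Group G] (S : Set G) (g : G) (l : ℕ) : Prop :=
  IsLeast {n : ℕ | ∃ w : List G, (∀ x ∈ w, x ∈ S ∨ x⁻¹ ∈ S) ∧ w.prod = g ∧ w.length = n} l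

/-- The sphere of radius `l`: the elements of word-length `l`. -/
def wordSphere {G : Type*} [Group G] (S : Set G) (l : ℕ) : Set G :=
  {g | HasWordLength S g l}

/-- The spherical exponential growth rate `limsup_l (a_l) ^ (1 / l)`, where `a_l` is the number of
elements of word-length `l`, for a finite generating set `S`. The two lemmas
below show that for finite `S` the numbers `a_l` are finite and the sequence is bounded, so that
neither `Set.ncard` nor the real `limsup` takes a default value. -/
noncomputable def sphericalGrowthRate {G : Type*} [Group G] (S : Set G) : ℝ :=
  limsup (fun l : ℕ => ((wordSphere S l).ncard : ℝ) ^ (1 / (l : ℝ))) atTop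

theorem wordSphere_finite_and_ncard_le {G : Type*} [Group G] {S : Set G} (hS : S.Finite) (l : ℕ) :
    (wordSphere S l).Finite ∧ (wordSphere S l).ncard ≤ (S ∪ S⁻¹).ncard ^ l := by
  have hT : (S ∪ S⁻¹).Finite := hS.union hS.inv
  have : Finite ↥(S ∪ S⁻¹) := hT
  let F : (Fin l → ↥(S ∪ S⁻¹)) → G := fun f => (List.ofFn fun i => (f i : G)).prod
  have hsub : wordSphere S l ⊆ Set.range F := by
    rintro g ⟨⟨w, hw, hg, hl⟩, -⟩
    subst hl
    refine ⟨fun i => ⟨w.get i, ?_⟩, ?_⟩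
    · simpa using hw _ (List.get_mem w i)
    · simp only [F]
      rw [List.ofFn_get, hg]
  refine ⟨(Set.finite_range F).subset hsub, ?_⟩
  refine (Set.ncard_le_ncard hsub (Set.finite_range F)).trans ?_
  rw [← Set.image_univ]
  refine (Set.ncard_image_le Set.finite_univ).trans ?_
  rw [Set.ncard_univ, Nat.card_fun, Nat.card_fin, Nat.card_coe_set_eq]

theorem sphericalGrowthRate_bounded {G : Type*} [Group G] {S : Set G} (hS : S.Finite) :
    BddAbove (Set.range fun l : ℕ => ((wordSphere S l).ncard : ℝ) ^ (1 / (l : ℝ))) := by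
  refine ⟨((S ∪ S⁻¹).ncard : ℝ) + 1, ?_⟩
  rintro _ ⟨l, rfl⟩
  have hc : (0 : ℝ) ≤ ((S ∪ S⁻¹).ncard : ℝ) := Nat.cast_nonneg _
  rcases Nat.eq_zero_or_pos l with rfl | hl
  · simp
  · have h1 : ((wordSphere S l).ncard : ℝ) ≤ ((S ∪ S⁻¹).ncard : ℝ) ^ l := by
      exact_mod_cast (wordSphere_finite_and_ncard_le hS l).2
    have h2 := Real.rpow_le_rpow (Nat.cast_nonneg _) h1
      (by positivity : (0 : ℝ) ≤ 1 / (l : ℝ))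
    rw [one_div, Real.pow_rpow_inv_natCast hc hl.ne'] at h2
    simp only [one_div]
    linarith

/-- A Perron number: a real algebraic integer greater than `1` that is greater than the absolute
value of each of its other Galois conjugates (in `ℂ`, over `ℚ`). -/
def IsPerronNumber (x : ℝ) : Prop :=
  IsIntegral ℤ x ∧ 1 < x ∧ ∀ z : ℂ, IsConjRoot ℚ (x : ℂ) z → z ≠ (x : ℂ) → ‖z‖ < x

/-! Write `F_U(t)` for the sum of `(-t/(1+t))^|S|` over the cliques `S` inside a vertex set `U`.
Inclusion-exclusion over left descents gives Steinberg's formula: the growth series of `G` is `1 /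
F_V`. The descents come from a normal form: a reduced word is determined, up to swaps of commuting
letters, by its projections to the pairs of non-adjacent vertices, and the generators act on these
families of projections.

Put `W_U = 1 / F_U`. For a vertex `v` outside `U` with link `L` in `U`, the recursion for clique
sums takes the form `(1 + t) F_{U ∪ v} = F_U (1 - C)` with `C = t (W_U / W_L - 1)`. By induction,
all quotients `W_U / W_T` with `T ⊆ U` have non-negative coefficients, and so does `C`.

If `α > 1`, then `r = 1/α < 1` is the radius of convergence of the growth series, and non-negativity
forces `F_V(r) = 0` (Pringsheim). Pass to a minimal `U` with `F_U(r) = 0` and remove a vertex `v`,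
leaving `T`. In the closed disc of radius `r` the function `F_T` has no zero, so the zeros of `F_U`
there solve `C(z) = 1`. As `C(r) = 1` and the coefficient of `t^2` in `C` is positive, the equality
case of the triangle inequality leaves only `z = ±r`, and `F_U(-r) > 0` excludes `-r`. Clearing
denominators in `F_U` and substituting `1/z` yields a monic integer polynomial with root `α`, whose
other roots are all smaller than `α` in absolute value. The conjugates of `α` are among these roots.
-/

namespace RACG

/-! ### Projections of words to pairs of non-adjacent vertices -/

variable {V : Type*} (Γ : SimpleGraph V)

/-- The coordinate `i`, a pair of non-adjacent vertices, records the letter `v`. -/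
def Touches (v : V) (i : V × V) : Prop :=
  ¬ Γ.Adj i.1 i.2 ∧ (v = i.1 ∨ v = i.2)

/-- The diagonal coordinate ensures that every letter is recorded somewhere, even one adjacent to
all other vertices. -/
theorem touches_self (v : V) : Touches Γ v (v, v) :=
  ⟨Γ.irrefl, Or.inl rfl⟩

variable {Γ}

/-- Commuting letters are recorded in disjoint sets of coordinates. All commutation rules for `push`
and `pop` rest on this. -/
theorem not_touches_of_adj {u v : V} {i : V × V} (h : Γ.Adj u v) (hu : Touches Γ u i) :
    ¬ Touches Γ v i := by
  rintro ⟨h1, h2⟩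
  obtain ⟨-, h3⟩ := hu
  have := h.ne
  have := h.symm
  grind

variable (Γ)

open Classical in
/-- Put the letter `v` in front of a family of words, in all coordinates that record it. -/
noncomputable def push (v : V) (x : V × V → List V) : V × V → List V :=
  fun i => if Touches Γ v i then v :: x i else x i

open Classical in
/-- Remove the first letter in all coordinates that record the letter `v`. -/
noncomputable def pop (v : V) (x : V × V → List V) : V × V → List V :=
  fun i => if Touches Γ v i then (x i).tail else x i

/-- All coordinates that record the letter `v` start with `v`. -/
def Removable (v : V) (x : V × V → List V) : Prop :=
  ∀ i, Touches Γ v i → (x i).head? = some v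

variable {Γ}

theorem pop_push (v : V) (x : V × V → List V) : pop Γ v (push Γ v x) = x := by
  ext1 i
  by_cases h : Touches Γ v i <;> simp [pop, push, h]

theorem removable_push (v : V) (x : V × V → List V) : Removable Γ v (push Γ v x) := by
  intro i h
  simp [push, h]

theorem push_pop {v : V} {x : V × V → List V} (hx : Removable Γ v x) :
    push Γ v (pop Γ v x) = x := by
  ext1 i
  by_cases h : Touches Γ v i
  · simp only [pop, push, h, if_true]
    exact List.cons_head?_tail (hx i h)
  · simp [pop, push, h]

theorem removable_push_iff {u v : V} (h : Γ.Adj u v) (x : V × V → List V) :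
    Removable Γ u (push Γ v x) ↔ Removable Γ u x := by
  refine forall₂_congr fun i hi => ?_
  simp [push, not_touches_of_adj h hi]

theorem removable_pop_iff {u v : V} (h : Γ.Adj u v) (x : V × V → List V) :
    Removable Γ u (pop Γ v x) ↔ Removable Γ u x := by
  refine forall₂_congr fun i hi => ?_
  simp [pop, not_touches_of_adj h hi]

theorem pop_push_comm {u v : V} (h : Γ.Adj u v) (x : V × V → List V) :
    pop Γ u (push Γ v x) = push Γ v (pop Γ u x) := by
  ext1 i
  by_cases hu : Touches Γ u i
  · simp [pop, push, hu, not_touches_of_adj h hu]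
  · simp [pop, push, hu]

theorem push_push_comm {u v : V} (h : Γ.Adj u v) (x : V × V → List V) :
    push Γ u (push Γ v x) = push Γ v (push Γ u x) := by
  ext1 i
  by_cases hu : Touches Γ u i
  · simp [push, hu, not_touches_of_adj h hu]
  · simp [push, hu]

theorem pop_pop_comm {u v : V} (h : Γ.Adj u v) (x : V × V → List V) :
    pop Γ u (pop Γ v x) = pop Γ v (pop Γ u x) := by
  ext1 i
  by_cases hu : Touches Γ u i
  · simp [pop, hu, not_touches_of_adj h hu]
  · simp [pop, hu]

/-- Otherwise the coordinate `(u, v)` would have to start with both letters. -/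
theorem adj_of_removable {u v : V} {x : V × V → List V} (hu : Removable Γ u x)
    (hv : Removable Γ v x) (huv : u ≠ v) : Γ.Adj u v := by
  by_contra h
  have h1 := hu (u, v) ⟨h, Or.inl rfl⟩
  have h2 := hv (u, v) ⟨h, Or.inr rfl⟩
  rw [h1] at h2
  exact huv (Option.some.inj h2)

theorem not_removable_nil (v : V) : ¬ Removable Γ v fun _ => [] := by
  intro h
  simpa using h (v, v) (touches_self Γ v)

/-! ### Reduced words and their uniqueness -/

theorem of_mul_of (v : V) :
    (PresentedGroup.of v : RACG Γ) * PresentedGroup.of v = 1 := by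
  have h : (PresentedGroup.mk (racgRelators Γ)) (FreeGroup.of v ^ 2) = 1 :=
    PresentedGroup.one_of_mem (Or.inl ⟨v, rfl⟩)
  rw [map_pow, pow_two] at h
  exact h

theorem of_mul_of_mul (v : V) (g : RACG Γ) :
    (PresentedGroup.of v : RACG Γ) * (PresentedGroup.of v * g) = g := by
  rw [← mul_assoc, of_mul_of, one_mul]

theorem of_inv (v : V) : (PresentedGroup.of v : RACG Γ)⁻¹ = PresentedGroup.of v :=
  inv_eq_of_mul_eq_one_left (of_mul_of v)

theorem of_mul_of_comm {u v : V} (h : Γ.Adj u v) :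
    (PresentedGroup.of u : RACG Γ) * PresentedGroup.of v =
      PresentedGroup.of v * PresentedGroup.of u := by
  have h : (PresentedGroup.mk (racgRelators Γ)) (FreeGroup.of u * FreeGroup.of v *
      (FreeGroup.of u)⁻¹ * (FreeGroup.of v)⁻¹) = 1 :=
    PresentedGroup.one_of_mem (Or.inr ⟨u, v, h, rfl⟩)
  simp only [map_mul, map_inv] at h
  rw [mul_inv_eq_one, mul_inv_eq_iff_eq_mul] at h
  exact h

variable (Γ) in
/-- `Represents Γ x n g`: some reduced word of length `n` with product `g` has the projections `x`. -/
inductive Represents : (V × V → List V) → ℕ → RACG Γ → Prop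
  | nil : Represents (fun _ => []) 0 1
  | cons {x : V × V → List V} {n : ℕ} {g : RACG Γ} {v : V} (h : Represents x n g)
      (hv : ¬ Removable Γ v x) : Represents (push Γ v x) (n + 1) (PresentedGroup.of v * g)

/-- A removable letter is either the first letter of the word or commutes with it, and in the second
case it is removed from the rest of the word. The last conjunct expresses reducedness: no second
copy of `v` is exposed. -/
theorem Represents.pop {x : V × V → List V} {n : ℕ} {g : RACG Γ} (h : Represents Γ x n g)
    {v : V} (hv : Removable Γ v x) :
    ∃ m, n = m + 1 ∧ Represents Γ (pop Γ v x) m (PresentedGroup.of v * g) ∧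
      ¬ Removable Γ v (RACG.pop Γ v x) := by
  induction h with
  | nil => exact absurd hv (not_removable_nil v)
  | @cons x n g w h hw ih =>
    by_cases hvw : v = w
    · subst hvw
      refine ⟨n, rfl, ?_, ?_⟩
      · rw [pop_push, of_mul_of_mul]
        exact h
      · rwa [pop_push]
    · have hadj := adj_of_removable hv (removable_push w x) hvw
      obtain ⟨m, rfl, h1, h2⟩ := ih ((removable_push_iff hadj x).1 hv)
      refine ⟨m + 1, rfl, ?_, ?_⟩
      · rw [pop_push_comm hadj, ← mul_assoc, of_mul_of_comm hadj, mul_assoc]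
        exact h1.cons (by rwa [removable_pop_iff hadj.symm])
      · rwa [pop_push_comm hadj, removable_push_iff hadj]

/-- The first letter of one word is removable from the common projections, hence can be cancelled
from the other word too. -/
theorem Represents.unique {x : V × V → List V} {n m : ℕ} {g k : RACG Γ}
    (h : Represents Γ x n g) (h' : Represents Γ x m k) : n = m ∧ g = k := by
  induction h generalizing m k with
  | nil =>
    generalize hx : (fun _ : V × V => ([] : List V)) = x at h'
    cases h' with
    | nil => exact ⟨rfl, rfl⟩
    | @cons y n g v =>
      exact absurd (hx ▸ removable_push v y) (not_removable_nil v)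
  | @cons x n g w h hw ih =>
    obtain ⟨l, rfl, h1, -⟩ := h'.pop (removable_push w x)
    rw [pop_push] at h1
    obtain ⟨rfl, rfl⟩ := ih h1
    exact ⟨rfl, of_mul_of_mul w k⟩

/-! ### The action of the group on reduced states -/

open Classical in
variable (Γ) in
/-- Multiplication by the generator `v` on the families of projections of reduced words. -/
noncomputable def toggle (v : V) (x : V × V → List V) : V × V → List V :=
  if Removable Γ v x then pop Γ v x else push Γ v x

theorem toggle_comm {u v : V} (h : Γ.Adj u v) (x : V × V → List V) :
    toggle Γ u (toggle Γ v x) = toggle Γ v (toggle Γ u x) := by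
  by_cases hu : Removable Γ u x <;> by_cases hv : Removable Γ v x <;>
    simp [toggle, hu, hv, removable_push_iff h, removable_push_iff h.symm, removable_pop_iff h,
      removable_pop_iff h.symm, pop_push_comm h, pop_push_comm h.symm, push_push_comm h,
      pop_pop_comm h]

theorem Represents.toggle {x : V × V → List V} {n : ℕ} {g : RACG Γ} (h : Represents Γ x n g)
    (v : V) : ∃ m ≤ n + 1, Represents Γ (toggle Γ v x) m (PresentedGroup.of v * g) := by
  by_cases hv : Removable Γ v x
  · obtain ⟨m, rfl, h1, -⟩ := h.pop hv
    exact ⟨m, by omega, by simpa [RACG.toggle, hv] using h1⟩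
  · exact ⟨n + 1, le_rfl, by simpa [RACG.toggle, hv] using h.cons hv⟩

/-- Reducedness is essential: on the projections of the word `v v`, toggling `v` twice removes both
letters. -/
theorem Represents.toggle_toggle {x : V × V → List V} {n : ℕ} {g : RACG Γ}
    (h : Represents Γ x n g) (v : V) : RACG.toggle Γ v (RACG.toggle Γ v x) = x := by
  by_cases hv : Removable Γ v x
  · obtain ⟨m, rfl, h1, h2⟩ := h.pop hv
    simp [RACG.toggle, hv, h2, push_pop hv]
  · simp [RACG.toggle, hv, removable_push, pop_push]

variable (Γ) in
/-- The families of projections of reduced words. -/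
abbrev ReducedState : Type _ := {x : V × V → List V // ∃ n g, Represents Γ x n g}

variable (Γ) in
/-- The permutation of the reduced states given by the generator `v`. -/
noncomputable def togglePerm (v : V) : Equiv.Perm (ReducedState Γ) :=
  Function.Involutive.toPerm
    (fun x => ⟨toggle Γ v x.1, by
      obtain ⟨n, g, h⟩ := x.2
      obtain ⟨m, -, h'⟩ := h.toggle v
      exact ⟨m, _, h'⟩⟩)
    (fun x => by
      obtain ⟨n, g, h⟩ := x.2
      exact Subtype.ext (h.toggle_toggle v))

variable (Γ) in
/-- The action of the group on the reduced states. -/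
noncomputable def stateAction : RACG Γ →* Equiv.Perm (ReducedState Γ) :=
  PresentedGroup.toGroup (f := togglePerm Γ) (by
    have hsq : ∀ v, togglePerm Γ v * togglePerm Γ v = 1 := fun v =>
      Equiv.ext fun x => (Function.Involutive.toPerm_involutive _) x
    rintro r (⟨v, rfl⟩ | ⟨u, v, h, rfl⟩)
    · simp [pow_two, hsq]
    · simp only [map_mul, map_inv, FreeGroup.lift_apply_of]
      rw [mul_inv_eq_one, mul_inv_eq_iff_eq_mul]
      exact Equiv.ext fun x => Subtype.ext (toggle_comm h x.1))

/-- The state of a group element: the projections of its reduced words. -/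
noncomputable def state (g : RACG Γ) : V × V → List V :=
  (stateAction Γ g ⟨fun _ => [], 0, 1, Represents.nil⟩).1

theorem state_one : state (1 : RACG Γ) = fun _ => [] := by
  simp [state]

theorem state_of_mul (v : V) (g : RACG Γ) :
    state (PresentedGroup.of v * g) = toggle Γ v (state g) := by
  simp only [state, map_mul, Equiv.Perm.mul_apply]
  simp only [stateAction, PresentedGroup.toGroup.of]
  rfl

theorem exists_word (g : RACG Γ) : ∃ w : List V, (w.map PresentedGroup.of).prod = g := by
  obtain ⟨z, rfl⟩ := PresentedGroup.mk_surjective _ g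
  induction z using FreeGroup.induction_on with
  | C1 => exact ⟨[], by simp⟩
  | of v => exact ⟨[v], by simp [PresentedGroup.of]⟩
  | inv_of v _ => exact ⟨[v], by simpa [PresentedGroup.of] using (of_inv (Γ := Γ) v).symm⟩
  | mul a b ha hb =>
    obtain ⟨w, hw⟩ := ha
    obtain ⟨w', hw'⟩ := hb
    exact ⟨w ++ w', by simp [hw, hw']⟩

/-- Each letter raises the represented length by at most one, so this length bounds from below the
length of any word for the element. -/
theorem exists_represents_le (w : List V) :
    ∃ m ≤ w.length, Represents Γ (state (Γ := Γ) (w.map PresentedGroup.of).prod) m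
      (w.map PresentedGroup.of).prod := by
  induction w with
  | nil => exact ⟨0, le_rfl, by simpa [state_one] using Represents.nil⟩
  | cons v w ih =>
    obtain ⟨m, hm, h⟩ := ih
    obtain ⟨k, hk, h'⟩ := h.toggle v
    refine ⟨k, by simp; omega, ?_⟩
    rw [List.map_cons, List.prod_cons, state_of_mul]
    exact h'

theorem exists_represents (g : RACG Γ) : ∃ m, Represents Γ (state g) m g := by
  obtain ⟨w, rfl⟩ := exists_word g
  obtain ⟨m, -, h⟩ := exists_represents_le (Γ := Γ) w
  exact ⟨m, h⟩

/-! ### Word length and left descents -/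

/-- The word length of a group element. -/
noncomputable def len (g : RACG Γ) : ℕ := (exists_represents g).choose

theorem represents_len (g : RACG Γ) : Represents Γ (state g) (len g) g :=
  (exists_represents g).choose_spec

theorem Represents.exists_word {x : V × V → List V} {n : ℕ} {g : RACG Γ}
    (h : Represents Γ x n g) : ∃ w : List V, w.length = n ∧ (w.map PresentedGroup.of).prod = g := by
  induction h with
  | nil => exact ⟨[], by simp⟩
  | @cons x n g v h hv ih =>
    obtain ⟨w, rfl, rfl⟩ := ih
    exact ⟨v :: w, by simp⟩

theorem hasWordLength_len (g : RACG Γ) : HasWordLength (racgGenerators Γ) g (len g) := by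
  constructor
  · obtain ⟨w, hw, hg⟩ := (represents_len g).exists_word
    refine ⟨w.map PresentedGroup.of, ?_, hg, by simpa using hw⟩
    intro x hx
    obtain ⟨v, -, rfl⟩ := List.mem_map.1 hx
    exact Or.inl ⟨v, rfl⟩
  · rintro n ⟨w, hw, rfl, rfl⟩
    -- Generators are their own inverses, so admitting inverse letters adds nothing.
    obtain ⟨w', rfl⟩ : ∃ w' : List V, w'.map PresentedGroup.of = w := by
      induction w with
      | nil => exact ⟨[], rfl⟩
      | cons a w ih =>
        obtain ⟨w', rfl⟩ := ih fun x hx => hw x (List.mem_cons_of_mem _ hx)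
        have ha : ∃ v : V, PresentedGroup.of v = a := by
          rcases hw a List.mem_cons_self with ⟨v, hv⟩ | ⟨v, hv⟩
          · exact ⟨v, hv⟩
          · exact ⟨v, by rw [← of_inv]; simp only at hv; rw [hv, inv_inv]⟩
        obtain ⟨v, rfl⟩ := ha
        exact ⟨v :: w', rfl⟩
    obtain ⟨m, hm, h⟩ := exists_represents_le (Γ := Γ) w'
    rw [((represents_len _).unique h).1]
    simpa using hm

theorem wordSphere_eq (l : ℕ) : wordSphere (racgGenerators Γ) l = {g | len g = l} := by
  ext g
  exact ⟨fun h => (hasWordLength_len g).unique h, fun h => h ▸ hasWordLength_len g⟩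

theorem len_one : len (1 : RACG Γ) = 0 := by
  have h := represents_len (1 : RACG Γ)
  rw [state_one] at h
  exact (h.unique Represents.nil).1

/-- `v` is a left descent of `g`. -/
def Descent (g : RACG Γ) (v : V) : Prop := Removable Γ v (state g)

theorem len_of_mul_of_not_descent {g : RACG Γ} {v : V} (h : ¬ Descent g v) :
    len (PresentedGroup.of v * g) = len g + 1 := by
  have h1 := represents_len (PresentedGroup.of v * g)
  rw [state_of_mul, toggle, if_neg (show ¬ Removable Γ v (state g) from h)] at h1
  exact (h1.unique ((represents_len g).cons h)).1

theorem descent_of_mul_self {g : RACG Γ} {v : V} :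
    Descent (PresentedGroup.of v * g) v ↔ ¬ Descent g v := by
  rw [Descent, state_of_mul, toggle]
  split_ifs with h
  · obtain ⟨m, -, -, h2⟩ := (represents_len g).pop h
    exact iff_of_false h2 (not_not.2 h)
  · exact iff_of_true (removable_push _ _) h

theorem descent_of_mul_of_adj {g : RACG Γ} {u v : V} (h : Γ.Adj u v) :
    Descent (PresentedGroup.of v * g) u ↔ Descent g u := by
  rw [Descent, state_of_mul, toggle]
  split_ifs
  · exact removable_pop_iff h _
  · exact removable_push_iff h _

theorem Descent.adj {g : RACG Γ} {u v : V} (hu : Descent g u) (hv : Descent g v) (h : u ≠ v) :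
    Γ.Adj u v :=
  adj_of_removable hu hv h

theorem not_descent_one (v : V) : ¬ Descent (1 : RACG Γ) v := by
  rw [Descent, state_one]
  exact not_removable_nil v

theorem exists_descent {g : RACG Γ} (hg : g ≠ 1) : ∃ v, Descent g v := by
  have h := represents_len g
  generalize hx : state g = x at h
  generalize len g = n at h
  cases h with
  | nil => exact absurd rfl hg
  | @cons y m k v h hv => exact ⟨v, by rw [Descent, hx]; exact removable_push v y⟩

end RACG

/-! ### Steinberg's formula for the growth series -/

namespace RACG

open PowerSeries

variable {V : Type*} (Γ : SimpleGraph V)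

open Classical in
/-- The clique polynomial of the subgraph of `Γ` induced on `U`, evaluated at `-y`. -/
noncomputable def cliqueSum {R : Type*} [CommRing R] (U : Finset V) (y : R) : R :=
  ∑ S ∈ U.powerset.filter fun S : Finset V => Γ.IsClique (S : Set V), (-y) ^ S.card

variable {Γ}

theorem cliqueSum_empty {R : Type*} [CommRing R] (y : R) : cliqueSum Γ ∅ y = 1 := by
  simp [cliqueSum, Finset.filter_singleton]

open Classical in
-- Cliques containing `v` are `v` together with a clique in the link of `v`.
theorem cliqueSum_insert {R : Type*} [CommRing R] {U : Finset V} {v : V} (hv : v ∉ U) (y : R) :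
    cliqueSum Γ (insert v U) y =
      cliqueSum Γ U y - y * cliqueSum Γ (U.filter (Γ.Adj v)) y := by
  have h : ∑ S ∈ U.powerset.filter fun S : Finset V => Γ.IsClique (insert v S : Finset V),
      (-y) ^ (insert v S).card =
      -(y * cliqueSum Γ (U.filter (Γ.Adj v)) y) := by
    have hset : U.powerset.filter (fun S : Finset V => Γ.IsClique (insert v S : Finset V)) =
        (U.filter (Γ.Adj v)).powerset.filter (fun S : Finset V => Γ.IsClique (S : Set V)) := by
      ext S
      simp only [Finset.mem_filter, Finset.mem_powerset, Finset.coe_insert,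
        SimpleGraph.isClique_insert, Finset.subset_iff]
      constructor
      · rintro ⟨h1, h2, h3⟩
        exact ⟨fun x hx => ⟨h1 hx, h3 x hx (by rintro rfl; exact hv (h1 hx))⟩, h2⟩
      · rintro ⟨h1, h2⟩
        exact ⟨fun x hx => (h1 hx).1, h2, fun x hx _ => (h1 hx).2⟩
    rw [hset, cliqueSum, Finset.mul_sum, ← Finset.sum_neg_distrib]
    refine Finset.sum_congr rfl fun S hS => ?_
    have hvS : v ∉ S := fun h =>
      hv (Finset.mem_filter.1 (Finset.mem_powerset.1 (Finset.mem_filter.1 hS).1 h)).1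
    rw [Finset.card_insert_of_notMem hvS]
    ring
  rw [cliqueSum, Finset.sum_filter, Finset.sum_powerset_insert hv, ← Finset.sum_filter,
    ← Finset.sum_filter, h, sub_eq_add_neg]
  rfl

/-- The power series `t / (1 + t)`. -/
noncomputable def shiftSeries : ℝ⟦X⟧ := X * (1 + X)⁻¹

theorem one_add_X_mul_shiftSeries : (1 + X) * shiftSeries = X := by
  rw [shiftSeries, mul_left_comm, PowerSeries.mul_inv_cancel _ (by simp), mul_one]

variable (Γ) in
/-- The generating function of the elements of which all vertices in `S` are left descents. -/
noncomputable def descentSeries (S : Finset V) : ℝ⟦X⟧ :=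
  mk fun l => ({g : RACG Γ | len g = l ∧ ∀ v ∈ S, Descent g v}.ncard : ℝ)

variable (Γ) in
/-- The spherical growth series. -/
noncomputable def growthSeries : ℝ⟦X⟧ :=
  mk fun l => ((wordSphere (racgGenerators Γ) l).ncard : ℝ)

theorem descentSeries_empty : descentSeries Γ ∅ = growthSeries Γ := by
  simp [descentSeries, growthSeries, wordSphere_eq]

theorem descentSeries_of_not_isClique {S : Finset V} (hS : ¬ Γ.IsClique (S : Set V)) :
    descentSeries Γ S = 0 := by
  ext l
  simp only [descentSeries, coeff_mk, map_zero, Nat.cast_eq_zero]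
  convert Set.ncard_empty (RACG Γ)
  rw [Set.eq_empty_iff_forall_notMem]
  rintro g ⟨-, h⟩
  exact hS fun u hu v hv huv => (h u hu).adj (h v hv) huv

variable [Finite V]

theorem finite_len_eq (l : ℕ) : {g : RACG Γ | len g = l}.Finite := by
  rw [← wordSphere_eq]
  exact (wordSphere_finite_and_ncard_le (Set.finite_range _) l).1

open Classical in
-- Left multiplication by `v` preserves the descents in `S`, toggles the descent `v`, and shifts
-- length by one. Hence `D_{S ∪ v} = t (D_S - D_{S ∪ v})` for the descent series `D`.
theorem descentSeries_insert {S : Finset V} {v : V} (hv : v ∉ S)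
    (hS : Γ.IsClique (insert v S : Finset V)) :
    descentSeries Γ (insert v S) = shiftSeries * descentSeries Γ S := by
  have hadj : ∀ u ∈ S, Γ.Adj u v := fun u hu =>
    hS (by simp [hu]) (by simp) (by rintro rfl; exact hv hu)
  have hsplit : ∀ l, {g : RACG Γ | len g = l ∧ ∀ u ∈ S, Descent g u}.ncard =
      {g : RACG Γ | len g = l ∧ ∀ u ∈ insert v S, Descent g u}.ncard +
      {g : RACG Γ | len g = l ∧ (∀ u ∈ S, Descent g u) ∧ ¬ Descent g v}.ncard := by
    intro l
    rw [← Set.ncard_union_eq ?_ ((finite_len_eq l).subset fun g hg => hg.1)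
      ((finite_len_eq l).subset fun g hg => hg.1)]
    · congr 1
      ext g
      simp only [Set.mem_ofPred_eq, Finset.forall_mem_insert, Set.mem_union]
      tauto
    · rw [Set.disjoint_left]
      rintro g ⟨-, h1⟩ ⟨-, -, h2⟩
      exact h2 (h1 v (Finset.mem_insert_self v S))
  have hshift : ∀ l, {g : RACG Γ | len g = l + 1 ∧ ∀ u ∈ insert v S, Descent g u}.ncard =
      {g : RACG Γ | len g = l ∧ (∀ u ∈ S, Descent g u) ∧ ¬ Descent g v}.ncard := by
    intro l
    symm
    refine Set.ncard_congr (fun g _ => PresentedGroup.of v * g) ?_ ?_ ?_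
    · rintro g ⟨rfl, h1, h2⟩
      refine ⟨len_of_mul_of_not_descent h2, ?_⟩
      rw [Finset.forall_mem_insert]
      exact ⟨descent_of_mul_self.2 h2, fun u hu => (descent_of_mul_of_adj (hadj u hu)).2 (h1 u hu)⟩
    · intro g k _ _ h
      exact mul_left_cancel h
    · rintro g ⟨h1, h2⟩
      rw [Finset.forall_mem_insert] at h2
      have hnd : ¬ Descent (PresentedGroup.of v * g) v := fun h => descent_of_mul_self.1 h h2.1
      refine ⟨PresentedGroup.of v * g, ⟨?_, ?_, hnd⟩, of_mul_of_mul v g⟩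
      · have := len_of_mul_of_not_descent hnd
        rw [of_mul_of_mul] at this
        omega
      · exact fun u hu => (descent_of_mul_of_adj (hadj u hu)).2 (h2.2 u hu)
  have hzero : {g : RACG Γ | len g = 0 ∧ ∀ u ∈ insert v S, Descent g u}.ncard = 0 := by
    convert Set.ncard_empty (RACG Γ)
    rw [Set.eq_empty_iff_forall_notMem]
    rintro g ⟨h1, h2⟩
    have hd := h2 v (Finset.mem_insert_self v S)
    have hnd : ¬ Descent (PresentedGroup.of v * g) v := fun h => descent_of_mul_self.1 h hd
    have := len_of_mul_of_not_descent hnd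
    rw [of_mul_of_mul] at this
    omega
  have h1X : (1 + X : ℝ⟦X⟧) ≠ 0 := by
    intro h
    simpa using congrArg constantCoeff h
  refine mul_left_cancel₀ h1X ?_
  rw [← mul_assoc, one_add_X_mul_shiftSeries, add_mul, one_mul]
  ext l
  cases l with
  | zero =>
    rw [map_add, coeff_zero_X_mul, coeff_zero_X_mul, descentSeries, coeff_mk, hzero]
    simp
  | succ l =>
    simp only [map_add, coeff_succ_X_mul, descentSeries, coeff_mk]
    rw [hshift, hsplit l]
    push_cast
    ring

open Classical in
theorem descentSeries_of_isClique {S : Finset V} (hS : Γ.IsClique (S : Set V)) :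
    descentSeries Γ S = shiftSeries ^ S.card * growthSeries Γ := by
  induction S using Finset.induction_on with
  | empty => simp [descentSeries_empty]
  | insert v S hv ih =>
    rw [descentSeries_insert hv hS, ih (hS.subset (by simp)), Finset.card_insert_of_notMem hv]
    ring

/-- An element contributes the alternating sum over subsets of its descent set, which vanishes
unless that set is empty; only the identity has no descent. -/
theorem sum_neg_one_pow_mul_descentSeries [Fintype V] :
    ∑ S : Finset V, (-1) ^ S.card * descentSeries Γ S = 1 := by
  classical
  ext l
  have hcard : ∀ S : Finset V, {g : RACG Γ | len g = l ∧ ∀ v ∈ S, Descent g v}.ncard =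
      ∑ g ∈ (finite_len_eq (Γ := Γ) l).toFinset,
        if S ∈ (Finset.univ.filter (Descent g)).powerset then 1 else 0 := by
    intro S
    rw [← Finset.card_filter, ← Set.ncard_coe_finset]
    congr 1
    ext g
    simp [Finset.subset_iff]
  have hpow : ∀ S : Finset V, ((-1 : ℝ⟦X⟧)) ^ S.card = C ((-1 : ℝ) ^ S.card) := by
    intro S
    simp
  simp only [map_sum, hpow, coeff_C_mul, descentSeries, coeff_mk, hcard]
  push_cast
  simp only [Finset.mul_sum]
  rw [Finset.sum_comm]
  have hinner : ∀ g : RACG Γ, ∑ S : Finset V, (-1 : ℝ) ^ S.card *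
      (if S ∈ (Finset.univ.filter (Descent g)).powerset then 1 else 0) =
      if g = 1 then 1 else 0 := by
    intro g
    simp only [mul_ite, mul_one, mul_zero]
    rw [← Finset.sum_filter, Finset.filter_mem_eq_inter, Finset.univ_inter]
    have h := Finset.sum_powerset_neg_one_pow_card (x := Finset.univ.filter (Descent g))
    have h' := congrArg (Int.cast : ℤ → ℝ) h
    push_cast at h'
    rw [h']
    refine if_congr ?_ rfl rfl
    rw [Finset.filter_eq_empty_iff]
    constructor
    · intro h
      by_contra hg
      obtain ⟨v, hv⟩ := exists_descent hg
      exact h (Finset.mem_univ v) hv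
    · rintro rfl v -
      exact not_descent_one v
  rw [Finset.sum_congr rfl fun g _ => hinner g, Finset.sum_ite_eq', coeff_one]
  simp [len_one, eq_comm]

theorem growthSeries_mul_cliqueSum [Fintype V] :
    growthSeries Γ * cliqueSum Γ Finset.univ shiftSeries = 1 := by
  classical
  rw [← sum_neg_one_pow_mul_descentSeries (Γ := Γ), cliqueSum, Finset.mul_sum,
    Finset.powerset_univ, Finset.sum_filter]
  refine Finset.sum_congr rfl fun S _ => ?_
  split_ifs with hS
  · rw [descentSeries_of_isClique hS, neg_pow]
    ring
  · rw [descentSeries_of_not_isClique hS, mul_zero]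

end RACG

/-! ### Non-negativity of quotients of growth series -/

namespace RACG

open PowerSeries

/-- All coefficients are non-negative. -/
def NonnegCoeffs (A : ℝ⟦X⟧) : Prop := ∀ n, 0 ≤ coeff n A

theorem NonnegCoeffs.one : NonnegCoeffs 1 := by
  intro n
  rw [coeff_one]
  split_ifs <;> norm_num

theorem NonnegCoeffs.X : NonnegCoeffs (X : ℝ⟦X⟧) := by
  intro n
  rw [coeff_X]
  split_ifs <;> norm_num

theorem NonnegCoeffs.add {A B : ℝ⟦X⟧} (hA : NonnegCoeffs A) (hB : NonnegCoeffs B) :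
    NonnegCoeffs (A + B) := fun n => by
  rw [map_add]
  exact add_nonneg (hA n) (hB n)

theorem NonnegCoeffs.mul {A B : ℝ⟦X⟧} (hA : NonnegCoeffs A) (hB : NonnegCoeffs B) :
    NonnegCoeffs (A * B) := fun n => by
  rw [coeff_mul]
  exact Finset.sum_nonneg fun p _ => mul_nonneg (hA _) (hB _)

theorem NonnegCoeffs.sub_one {A : ℝ⟦X⟧} (hA : NonnegCoeffs A) (h : constantCoeff A = 1) :
    NonnegCoeffs (A - 1) := fun n => by
  rw [map_sub, coeff_one]
  split_ifs with hn
  · rw [hn, coeff_zero_eq_constantCoeff_apply, h, sub_self]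
  · simpa using hA n

/-- In `B = 1 + A * B` the vanishing constant term of `A` expresses each coefficient of `B` through
earlier ones. -/
theorem NonnegCoeffs.inv_one_sub {A : ℝ⟦X⟧} (hA : NonnegCoeffs A) (h : constantCoeff A = 0) :
    NonnegCoeffs (1 - A)⁻¹ := by
  have hinv : (1 - A)⁻¹ = 1 + A * (1 - A)⁻¹ := by
    have := PowerSeries.mul_inv_cancel (1 - A) (by simp [h])
    linear_combination this
  intro n
  induction n using Nat.strong_induction_on with
  | _ n ih =>
  rw [hinv, map_add]
  refine add_nonneg (NonnegCoeffs.one n) ?_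
  rw [coeff_mul]
  refine Finset.sum_nonneg fun p hp => ?_
  by_cases h0 : p.1 = 0
  · rw [h0, coeff_zero_eq_constantCoeff_apply, h, zero_mul]
  · have := Finset.HasAntidiagonal.mem_antidiagonal.1 hp
    exact mul_nonneg (hA _) (ih _ (by omega))

/-- Multiplication by a series with non-negative coefficients and constant term `1` does not
decrease coefficients. -/
theorem NonnegCoeffs.coeff_le_coeff_mul {A B : ℝ⟦X⟧} (hA : NonnegCoeffs A) (hB : NonnegCoeffs B)
    (h : constantCoeff A = 1) (n : ℕ) : coeff n B ≤ coeff n (A * B) := by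
  have := (hA.sub_one h).mul hB n
  rw [sub_mul, one_mul, map_sub] at this
  linarith

variable {V : Type*} {Γ : SimpleGraph V}

theorem constantCoeff_cliqueSum (U : Finset V) :
    constantCoeff (cliqueSum Γ U shiftSeries) = 1 := by
  classical
  induction U using Finset.induction_on with
  | empty => simp [cliqueSum_empty]
  | insert v U hv ih =>
    have h : constantCoeff shiftSeries = 0 := by simp [shiftSeries]
    rw [cliqueSum_insert hv, map_sub, map_mul, h, ih, zero_mul, sub_zero]

theorem coeff_one_cliqueSum (U : Finset V) :
    coeff 1 (cliqueSum Γ U shiftSeries) = -(U.card : ℝ) := by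
  classical
  induction U using Finset.induction_on with
  | empty => simp [cliqueSum_empty, coeff_one]
  | insert v U hv ih =>
    have h : coeff 1 (shiftSeries * cliqueSum Γ (U.filter (Γ.Adj v)) shiftSeries) = 1 := by
      rw [shiftSeries, mul_assoc, ← zero_add 1, coeff_succ_X_mul,
        coeff_zero_eq_constantCoeff_apply, map_mul, ← shiftSeries, constantCoeff_cliqueSum]
      simp
    rw [cliqueSum_insert hv, map_sub, ih, h, Finset.card_insert_of_notMem hv]
    push_cast
    ring

theorem inv_cliqueSum_mul_cliqueSum (U : Finset V) :
    (cliqueSum Γ U shiftSeries)⁻¹ * cliqueSum Γ U shiftSeries = 1 :=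
  PowerSeries.inv_mul_cancel _ (by simp [constantCoeff_cliqueSum])

variable (Γ) in
/-- The quotient of the growth series of the special subgroups generated by `U` and `T`. -/
noncomputable def growthQuotient (U T : Finset V) : ℝ⟦X⟧ :=
  (cliqueSum Γ U shiftSeries)⁻¹ * cliqueSum Γ T shiftSeries

theorem constantCoeff_growthQuotient (U T : Finset V) :
    constantCoeff (growthQuotient Γ U T) = 1 := by
  simp [growthQuotient, constantCoeff_cliqueSum]

theorem growthQuotient_self (U : Finset V) : growthQuotient Γ U U = 1 :=
  inv_cliqueSum_mul_cliqueSum U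

theorem cliqueSum_mul_growthQuotient (U T : Finset V) :
    cliqueSum Γ U shiftSeries * growthQuotient Γ U T = cliqueSum Γ T shiftSeries := by
  rw [growthQuotient, ← mul_assoc, mul_comm (cliqueSum Γ U shiftSeries),
    inv_cliqueSum_mul_cliqueSum, one_mul]

theorem growthQuotient_mul_growthQuotient (U T R : Finset V) :
    growthQuotient Γ U T * growthQuotient Γ T R = growthQuotient Γ U R := by
  rw [growthQuotient, mul_assoc, cliqueSum_mul_growthQuotient, growthQuotient]

open Classical in
variable (Γ) in
/-- The generating function of the return words to `v` in the amalgam decomposition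
of the group on `insert v U`. -/
noncomputable def returnSeries (v : V) (U : Finset V) : ℝ⟦X⟧ :=
  X * (growthQuotient Γ U (U.filter (Γ.Adj v)) - 1)

open Classical in
-- This is the growth-series form of the decomposition of the group on `insert v U` as the amalgam
-- of the group on `U` with the product of the link group and `ℤ/2`, over the link group.
theorem one_add_X_mul_cliqueSum_insert {U : Finset V} {v : V} (hv : v ∉ U) :
    (1 + X) * cliqueSum Γ (insert v U) shiftSeries =
      cliqueSum Γ U shiftSeries * (1 - returnSeries Γ v U) := by
  rw [cliqueSum_insert hv, returnSeries]
  linear_combination X * cliqueSum_mul_growthQuotient (Γ := Γ) U (U.filter (Γ.Adj v)) -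
    cliqueSum Γ (U.filter (Γ.Adj v)) shiftSeries * one_add_X_mul_shiftSeries

theorem constantCoeff_returnSeries (v : V) (U : Finset V) :
    constantCoeff (returnSeries Γ v U) = 0 := by
  simp [returnSeries]

open Classical in
theorem coeff_two_returnSeries (v : V) (U : Finset V) :
    coeff 2 (returnSeries Γ v U) = (U.card : ℝ) - ((U.filter (Γ.Adj v)).card : ℝ) := by
  have h := congrArg (coeff 1) (cliqueSum_mul_growthQuotient (Γ := Γ) U (U.filter (Γ.Adj v)))
  rw [coeff_one_mul, coeff_one_cliqueSum, coeff_one_cliqueSum, constantCoeff_cliqueSum,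
    constantCoeff_growthQuotient] at h
  rw [returnSeries, show (2 : ℕ) = 1 + 1 from rfl, coeff_succ_X_mul, map_sub, coeff_one]
  simp only [one_ne_zero, if_false]
  linarith

/-- For `v` in `U` but not in `T`, the quotient factors through `U.erase v`. The first factor is `(1
+ X) / (1 - C)` with `C` the return series of `v`. Both `C` and the second factor only involve
quotients over the smaller set `U.erase v`. -/
theorem nonnegCoeffs_growthQuotient {U T : Finset V} (hTU : T ⊆ U) :
    NonnegCoeffs (growthQuotient Γ U T) := by
  classical
  induction U using Finset.strongInduction generalizing T with
  | _ U ih =>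
  rcases hTU.eq_or_ssubset with rfl | hss
  · rw [growthQuotient_self]
    exact NonnegCoeffs.one
  · obtain ⟨v, hvU, hvT⟩ := Finset.exists_of_ssubset hss
    have hU : insert v (U.erase v) = U := Finset.insert_erase hvU
    have hlt : U.erase v ⊂ U := Finset.erase_ssubset hvU
    rw [← growthQuotient_mul_growthQuotient U (U.erase v) T]
    refine NonnegCoeffs.mul ?_ (ih _ hlt (Finset.subset_erase.2 ⟨hTU, hvT⟩))
    have hC : NonnegCoeffs (returnSeries Γ v (U.erase v)) :=
      NonnegCoeffs.X.mul ((ih _ hlt (Finset.filter_subset _ _)).sub_one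
        (constantCoeff_growthQuotient _ _))
    have h1 := one_add_X_mul_cliqueSum_insert (Γ := Γ) (Finset.notMem_erase v U)
    rw [hU] at h1
    have h2 := PowerSeries.mul_inv_cancel (1 - returnSeries Γ v (U.erase v))
      (by simp [constantCoeff_returnSeries])
    have h3 := inv_cliqueSum_mul_cliqueSum (Γ := Γ) U
    have h4 : growthQuotient Γ U (U.erase v) =
        (1 + X) * (1 - returnSeries Γ v (U.erase v))⁻¹ := by
      rw [growthQuotient]
      linear_combination (1 + X) * (1 - returnSeries Γ v (U.erase v))⁻¹ * h3 -
        (cliqueSum Γ U shiftSeries)⁻¹ * (1 - returnSeries Γ v (U.erase v))⁻¹ * h1 -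
        (cliqueSum Γ U shiftSeries)⁻¹ * cliqueSum Γ (U.erase v) shiftSeries * h2
    rw [h4]
    exact (NonnegCoeffs.one.add NonnegCoeffs.X).mul
      (hC.inv_one_sub (constantCoeff_returnSeries _ _))

theorem nonnegCoeffs_returnSeries (v : V) (U : Finset V) :
    NonnegCoeffs (returnSeries Γ v U) := by
  classical
  exact NonnegCoeffs.X.mul ((nonnegCoeffs_growthQuotient (Finset.filter_subset _ _)).sub_one
    (constantCoeff_growthQuotient _ _))

end RACG

/-! ### Evaluation of power series and the singularity at the radius of convergence -/

namespace RACG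

open PowerSeries Topology

/-- The series `A` converges absolutely at `z`, with sum `s`. -/
def EvaluatesTo (A : ℝ⟦X⟧) (z s : ℂ) : Prop :=
  Summable (fun n => ‖((coeff n A : ℝ) : ℂ) * z ^ n‖) ∧ HasSum (fun n => ((coeff n A : ℝ) : ℂ) * z ^ n) s

namespace EvaluatesTo

variable {A B : ℝ⟦X⟧} {z a b : ℂ}

theorem of_summable (h : Summable (fun n => ‖((coeff n A : ℝ) : ℂ) * z ^ n‖)) : ∃ s, EvaluatesTo A z s :=
  ⟨_, h, h.of_norm.hasSum⟩

theorem unique (ha : EvaluatesTo A z a) (hb : EvaluatesTo A z b) : a = b :=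
  ha.2.unique hb.2

theorem add (ha : EvaluatesTo A z a) (hb : EvaluatesTo B z b) : EvaluatesTo (A + B) z (a + b) := by
  have h : ∀ n, ((coeff n (A + B) : ℝ) : ℂ) * z ^ n = ((coeff n A : ℝ) : ℂ) * z ^ n + ((coeff n B : ℝ) : ℂ) * z ^ n := by
    intro n
    rw [map_add]
    push_cast
    ring
  refine ⟨?_, by simpa only [h] using ha.2.add hb.2⟩
  exact Summable.of_nonneg_of_le (fun n => norm_nonneg _)
    (fun n => by rw [h]; exact norm_add_le _ _) (ha.1.add hb.1)

theorem neg (ha : EvaluatesTo A z a) : EvaluatesTo (-A) z (-a) := by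
  have h : ∀ n, ((coeff n (-A) : ℝ) : ℂ) * z ^ n = -(((coeff n A : ℝ) : ℂ) * z ^ n) := by
    intro n
    rw [map_neg]
    push_cast
    ring
  exact ⟨by simpa only [h, norm_neg] using ha.1, by simpa only [h] using ha.2.neg⟩

theorem sub (ha : EvaluatesTo A z a) (hb : EvaluatesTo B z b) : EvaluatesTo (A - B) z (a - b) := by
  simpa only [sub_eq_add_neg] using ha.add hb.neg

theorem mul (ha : EvaluatesTo A z a) (hb : EvaluatesTo B z b) : EvaluatesTo (A * B) z (a * b) := by
  have h : ∀ n, ((coeff n (A * B) : ℝ) : ℂ) * z ^ n = ∑ p ∈ Finset.HasAntidiagonal.antidiagonal n,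
      (((coeff p.1 A : ℝ) : ℂ) * z ^ p.1) * (((coeff p.2 B : ℝ) : ℂ) * z ^ p.2) := by
    intro n
    rw [coeff_mul]
    push_cast
    rw [Finset.sum_mul]
    refine Finset.sum_congr rfl fun p hp => ?_
    rw [← Finset.HasAntidiagonal.mem_antidiagonal.1 hp, pow_add]
    ring
  have hs := summable_norm_sum_mul_antidiagonal_of_summable_norm ha.1 hb.1
  refine ⟨by simpa only [h] using hs, ?_⟩
  simp only [h]
  rw [← ha.2.tsum_eq, ← hb.2.tsum_eq,
    tsum_mul_tsum_eq_tsum_sum_antidiagonal_of_summable_norm ha.1 hb.1]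
  exact hs.of_norm.hasSum

theorem monomial (k : ℕ) (z : ℂ) : EvaluatesTo (X ^ k) z (z ^ k) := by
  have h : ∀ n, ((coeff n (X ^ k : ℝ⟦X⟧) : ℝ) : ℂ) * z ^ n = if n = k then z ^ k else 0 := by
    intro n
    rw [coeff_X_pow]
    split_ifs with hn
    · simp [hn]
    · simp
  constructor
  · refine summable_of_ne_finset_zero (s := {k}) fun n hn => ?_
    rw [h, if_neg (by simpa using hn), norm_zero]
  · simp only [h]
    exact hasSum_ite_eq k _

theorem one (z : ℂ) : EvaluatesTo 1 z 1 := by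
  simpa using monomial 0 z

theorem X (z : ℂ) : EvaluatesTo PowerSeries.X z z := by
  simpa using monomial 1 z

theorem zero (z : ℂ) : EvaluatesTo 0 z 0 := by
  simpa using (one z).sub (one z)

theorem pow (ha : EvaluatesTo A z a) (k : ℕ) : EvaluatesTo (A ^ k) z (a ^ k) := by
  induction k with
  | zero => simpa using one z
  | succ k ih => simpa only [pow_succ] using ih.mul ha

theorem sum {ι : Type*} (s : Finset ι) {f : ι → ℝ⟦X⟧} {g : ι → ℂ}
    (h : ∀ i ∈ s, EvaluatesTo (f i) z (g i)) : EvaluatesTo (∑ i ∈ s, f i) z (∑ i ∈ s, g i) := by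
  classical
  induction s using Finset.induction_on with
  | empty => simpa using zero z
  | insert i s hi ih =>
    rw [Finset.sum_insert hi, Finset.sum_insert hi]
    exact (h i (Finset.mem_insert_self i s)).add
      (ih fun j hj => h j (Finset.mem_insert_of_mem hj))

theorem shiftSeries (hz : ‖z‖ < 1) : EvaluatesTo RACG.shiftSeries z (z / (1 + z)) := by
  have h1 : (1 + PowerSeries.X : ℝ⟦X⟧)⁻¹ = PowerSeries.mk fun n => (-1 : ℝ) ^ n := by
    rw [PowerSeries.inv_eq_iff_mul_eq_one (by simp)]
    ext n
    rw [mul_add, mul_one, map_add]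
    cases n with
    | zero => simp
    | succ n => simp [coeff_succ_mul_X, coeff_one, pow_succ]
  have h2 : ∀ n, ((coeff n (1 + PowerSeries.X : ℝ⟦X⟧)⁻¹ : ℝ) : ℂ) * z ^ n = (-z) ^ n := by
    intro n
    rw [h1, coeff_mk, neg_pow z]
    push_cast
    ring
  rw [RACG.shiftSeries, div_eq_mul_inv]
  refine (X z).mul ⟨?_, ?_⟩
  · simp only [h2, norm_pow, norm_neg]
    exact summable_geometric_of_lt_one (norm_nonneg z) hz
  · simp only [h2]
    simpa using hasSum_geometric_of_norm_lt_one (ξ := -z) (by simpa using hz)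

theorem cliqueSum {V : Type*} {Γ : SimpleGraph V} (U : Finset V) (hz : ‖z‖ < 1) :
    EvaluatesTo (RACG.cliqueSum Γ U RACG.shiftSeries) z (RACG.cliqueSum Γ U (z / (1 + z))) :=
  sum _ fun _ _ => (shiftSeries hz).neg.pow _

end EvaluatesTo

theorem summable_norm_of_nonnegCoeffs {A : ℝ⟦X⟧} (hA : NonnegCoeffs A) {r : ℝ}
    (h : Summable fun n => coeff n A * r ^ n) {z : ℂ} (hz : ‖z‖ ≤ r) :
    Summable fun n => ‖((coeff n A : ℝ) : ℂ) * z ^ n‖ := by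
  refine Summable.of_nonneg_of_le (fun n => norm_nonneg _) (fun n => ?_) h
  rw [norm_mul, norm_pow, Complex.norm_real, Real.norm_of_nonneg (hA n)]
  exact mul_le_mul_of_nonneg_left (pow_le_pow_left₀ (norm_nonneg z) hz n) (hA n)

variable {V : Type*} {Γ : SimpleGraph V}

theorem map_cliqueSum {R S : Type*} [CommRing R] [CommRing S] (f : R →+* S) (U : Finset V) (y : R) :
    f (cliqueSum Γ U y) = cliqueSum Γ U (f y) := by
  simp [cliqueSum]

theorem ofReal_cliqueSum (U : Finset V) (r : ℝ) :
    ((cliqueSum Γ U (r / (1 + r)) : ℝ) : ℂ) = cliqueSum Γ U ((r : ℂ) / (1 + r)) := by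
  have := map_cliqueSum (Γ := Γ) Complex.ofRealHom U (r / (1 + r))
  simpa using this

theorem continuous_cliqueSum {R : Type*} [CommRing R] [TopologicalSpace R] [IsTopologicalRing R]
    (U : Finset V) : Continuous fun y : R => cliqueSum Γ U y := by
  unfold cliqueSum
  fun_prop

theorem cliqueSum_ne_zero {A : ℝ⟦X⟧} {U : Finset V}
    (hAU : A * cliqueSum Γ U shiftSeries = 1) {z : ℂ} (hz : ‖z‖ < 1)
    (h : Summable fun n => ‖((coeff n A : ℝ) : ℂ) * z ^ n‖) : cliqueSum Γ U (z / (1 + z)) ≠ 0 := by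
  obtain ⟨s, hs⟩ := EvaluatesTo.of_summable h
  have h1 := hs.mul (EvaluatesTo.cliqueSum (Γ := Γ) U hz)
  rw [hAU] at h1
  exact right_ne_zero_of_mul (h1.unique (EvaluatesTo.one z) ▸ one_ne_zero)

theorem sum_range_mul_cliqueSum_le {A : ℝ⟦X⟧} (hA : NonnegCoeffs A) {U : Finset V}
    (hAU : A * cliqueSum Γ U shiftSeries = 1) {r : ℝ} (hr0 : 0 ≤ r) (hr1 : r < 1)
    (h : Summable fun n => coeff n A * r ^ n) :
    0 < cliqueSum Γ U (r / (1 + r)) ∧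
      ∀ N, (∑ n ∈ Finset.range N, coeff n A * r ^ n) * cliqueSum Γ U (r / (1 + r)) ≤ 1 := by
  have hnn : ∀ n, 0 ≤ coeff n A * r ^ n := fun n => mul_nonneg (hA n) (pow_nonneg hr0 n)
  have hz : ‖(r : ℂ)‖ = r := by rw [Complex.norm_real, Real.norm_of_nonneg hr0]
  have hev : EvaluatesTo A r ((∑' n, coeff n A * r ^ n : ℝ) : ℂ) := by
    refine ⟨summable_norm_of_nonnegCoeffs hA h hz.le, ?_⟩
    have := Complex.hasSum_ofReal.2 h.hasSum
    simpa using this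
  have h1 := hev.mul (EvaluatesTo.cliqueSum (Γ := Γ) U (z := (r : ℂ)) (by rw [hz]; exact hr1))
  rw [hAU, ← ofReal_cliqueSum, ← Complex.ofReal_mul] at h1
  have h2 : (∑' n, coeff n A * r ^ n) * cliqueSum Γ U (r / (1 + r)) = 1 := by
    exact_mod_cast h1.unique (EvaluatesTo.one _)
  have h3 : 0 ≤ ∑' n, coeff n A * r ^ n := tsum_nonneg hnn
  have h4 : 0 < cliqueSum Γ U (r / (1 + r)) := by
    by_contra h
    nlinarith
  refine ⟨h4, fun N => le_of_le_of_eq ?_ h2⟩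
  exact mul_le_mul_of_nonneg_right (h.sum_le_tsum _ fun n _ => hnn n) h4.le

theorem continuousAt_cliqueSum_div (U : Finset V) {r : ℝ} (hr : 0 < r) :
    ContinuousAt (fun r : ℝ => cliqueSum Γ U (r / (1 + r))) r := by
  have h : ContinuousAt (fun r : ℝ => r / (1 + r)) r :=
    continuousAt_id.div (by fun_prop) (by positivity)
  exact (continuous_cliqueSum U).continuousAt.comp h

theorem cliqueSum_nonneg {A : ℝ⟦X⟧} (hA : NonnegCoeffs A) {U : Finset V}
    (hAU : A * cliqueSum Γ U shiftSeries = 1) {r : ℝ} (hr0 : 0 < r) (hr1 : r < 1)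
    (h : ∀ s, 0 < s → s < r → Summable fun n => coeff n A * s ^ n) :
    0 ≤ cliqueSum Γ U (r / (1 + r)) := by
  refine ge_of_tendsto ((continuousAt_cliqueSum_div U hr0).tendsto.mono_left
    (nhdsWithin_le_nhds (s := Set.Iio r))) ?_
  filter_upwards [Ioo_mem_nhdsLT hr0] with s hs
  exact (sum_range_mul_cliqueSum_le hA hAU hs.1.le (hs.2.trans hr1) (h s hs.1 hs.2)).1.le

/-- Below `r` each partial sum is at most the reciprocal of the clique sum; a partial sum is a
polynomial, so the bound survives the limit at `r`. -/
theorem summable_of_cliqueSum_ne_zero {A : ℝ⟦X⟧} (hA : NonnegCoeffs A) {U : Finset V}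
    (hAU : A * cliqueSum Γ U shiftSeries = 1) {r : ℝ} (hr0 : 0 < r) (hr1 : r < 1)
    (h : ∀ s, 0 < s → s < r → Summable fun n => coeff n A * s ^ n)
    (hne : cliqueSum Γ U (r / (1 + r)) ≠ 0) : Summable fun n => coeff n A * r ^ n := by
  have hpos : 0 < cliqueSum Γ U (r / (1 + r)) :=
    lt_of_le_of_ne (cliqueSum_nonneg hA hAU hr0 hr1 h) hne.symm
  refine summable_of_sum_range_le (c := 1 / cliqueSum Γ U (r / (1 + r)))
    (fun n => mul_nonneg (hA n) (pow_nonneg hr0.le n)) fun N => ?_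
  rw [le_div_iff₀ hpos]
  have hc : ContinuousAt (fun s : ℝ => (∑ n ∈ Finset.range N, coeff n A * s ^ n) *
      cliqueSum Γ U (s / (1 + s))) r :=
    ContinuousAt.mul (by fun_prop) (continuousAt_cliqueSum_div U hr0)
  refine le_of_tendsto (hc.tendsto.mono_left (nhdsWithin_le_nhds (s := Set.Iio r))) ?_
  filter_upwards [Ioo_mem_nhdsLT hr0] with s hs
  exact (sum_range_mul_cliqueSum_le hA hAU hs.1.le (hs.2.trans hr1) (h s hs.1 hs.2)).2 N

/-- A reciprocal of a clique sum with non-negative coefficients is singular at its radius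
of convergence. -/
theorem cliqueSum_eq_zero_of_radius {A : ℝ⟦X⟧} (hA : NonnegCoeffs A) {U : Finset V}
    (hAU : A * cliqueSum Γ U shiftSeries = 1) {r : ℝ} (hr0 : 0 < r) (hr1 : r < 1)
    (h : ∀ s, 0 < s → s < r → Summable fun n => coeff n A * s ^ n)
    (h' : ∀ s, r < s → ¬ Summable fun n => coeff n A * s ^ n) :
    cliqueSum Γ U (r / (1 + r)) = 0 := by
  by_contra hne
  have hsum := summable_of_cliqueSum_ne_zero hA hAU hr0 hr1 h hne
  set f : ℂ → ℂ := fun z => cliqueSum Γ U (z / (1 + z)) with hf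
  have hball : ∀ z ∈ Metric.ball (0 : ℂ) 1, 1 + z ≠ 0 := by
    intro z hz h0
    rw [eq_neg_of_add_eq_zero_right h0] at hz
    simp at hz
  have hdiff : DifferentiableOn ℂ f (Metric.ball 0 1) := by
    have h1 : DifferentiableOn ℂ (fun z : ℂ => z / (1 + z)) (Metric.ball 0 1) :=
      differentiableOn_id.div (by fun_prop) hball
    have h2 : Differentiable ℂ (fun y : ℂ => cliqueSum Γ U y) := by
      unfold cliqueSum
      fun_prop
    exact h2.comp_differentiableOn h1
  set O : Set ℂ := Metric.ball 0 1 ∩ f ⁻¹' {0}ᶜ with hO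
  have hOo : IsOpen O := hdiff.continuousOn.isOpen_inter_preimage Metric.isOpen_ball
    isOpen_compl_singleton
  have hKO : Metric.closedBall (0 : ℂ) r ⊆ O := by
    intro z hz
    rw [mem_closedBall_zero_iff] at hz
    exact ⟨by simpa using hz.trans_lt hr1, cliqueSum_ne_zero hAU (hz.trans_lt hr1)
      (summable_norm_of_nonnegCoeffs hA hsum hz)⟩
  -- Compactness makes `f` zero-free, hence `1 / f` holomorphic, on a slightly larger disc.
  obtain ⟨δ, hδ, hthick⟩ := (isCompact_closedBall (0 : ℂ) r).exists_cthickening_subset_open hOo hKO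
  rw [cthickening_closedBall hδ.le hr0.le] at hthick
  set ρ : NNReal := ⟨δ + r, by positivity⟩ with hρ
  have hg : DifferentiableOn ℂ (fun z => (f z)⁻¹) (Metric.closedBall 0 ρ) :=
    (hdiff.mono fun z hz => (hthick hz).1).inv fun z hz => (hthick hz).2
  have hps := hg.hasFPowerSeriesOnBall (by rw [← NNReal.coe_pos]; change 0 < δ + r; positivity)
  have hofs : HasFPowerSeriesAt (fun z => (f z)⁻¹)
      (FormalMultilinearSeries.ofScalars ℂ fun n => ((coeff n A : ℝ) : ℂ)) 0 := by
    rw [hasFPowerSeriesAt_iff]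
    filter_upwards [Metric.ball_mem_nhds (0 : ℂ) hr0] with z hz
    rw [mem_ball_zero_iff] at hz
    obtain ⟨s, hs⟩ := EvaluatesTo.of_summable (summable_norm_of_nonnegCoeffs hA hsum hz.le)
    have h1 := hs.mul (EvaluatesTo.cliqueSum (Γ := Γ) U (hz.trans hr1))
    rw [hAU] at h1
    have h2 : s = (f z)⁻¹ := eq_inv_of_mul_eq_one_left (h1.unique (EvaluatesTo.one z))
    rw [zero_add, ← h2]
    simpa [FormalMultilinearSeries.coeff_ofScalars, mul_comm] using hs.2
  -- The Taylor series of `1 / f` at `0` is `A`, which therefore converges beyond `r`.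
  have heq := hps.hasFPowerSeriesAt.eq_formalMultilinearSeries hofs
  rw [heq] at hps
  refine h' (r + δ / 2) (by linarith) ?_
  have hmem : ((r + δ / 2 : ℝ) : ℂ) ∈ Metric.eball (0 : ℂ) ρ := by
    rw [Metric.eball_coe, mem_ball_zero_iff, Complex.norm_real,
      Real.norm_of_nonneg (by positivity)]
    change r + δ / 2 < δ + r
    linarith
  have hs := (hps.hasSum hmem).summable
  rw [← Complex.summable_ofReal]
  refine hs.congr fun n => ?_
  rw [FormalMultilinearSeries.ofScalars_apply_eq, smul_eq_mul]
  push_cast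
  rfl

end RACG

/-! ### Uniqueness of the zero of smallest modulus -/

namespace RACG

open PowerSeries Topology

variable {V : Type*} {Γ : SimpleGraph V}

theorem summable_mono {A B : ℝ⟦X⟧} (hA : NonnegCoeffs A) (hAB : ∀ n, coeff n A ≤ coeff n B) {r : ℝ}
    (hr : 0 ≤ r) (h : Summable fun n => coeff n B * r ^ n) :
    Summable fun n => coeff n A * r ^ n :=
  h.of_nonneg_of_le (fun n => mul_nonneg (hA n) (pow_nonneg hr n))
    fun n => mul_le_mul_of_nonneg_right (hAB n) (pow_nonneg hr n)

theorem growthQuotient_empty_mul_cliqueSum (U : Finset V) :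
    growthQuotient Γ U ∅ * cliqueSum Γ U shiftSeries = 1 := by
  rw [mul_comm, cliqueSum_mul_growthQuotient, cliqueSum_empty]

theorem coeff_growthQuotient_le {U T R : Finset V} (hRT : R ⊆ T) (hTU : T ⊆ U) (n : ℕ) :
    coeff n (growthQuotient Γ T R) ≤ coeff n (growthQuotient Γ U R) := by
  rw [← growthQuotient_mul_growthQuotient U T R]
  exact (nonnegCoeffs_growthQuotient hTU).coeff_le_coeff_mul (nonnegCoeffs_growthQuotient hRT)
    (constantCoeff_growthQuotient _ _) n

theorem coeff_growthQuotient_le_empty {U T : Finset V} (hTU : T ⊆ U) (n : ℕ) :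
    coeff n (growthQuotient Γ U T) ≤ coeff n (growthQuotient Γ U ∅) := by
  rw [← growthQuotient_mul_growthQuotient U T ∅, mul_comm]
  exact (nonnegCoeffs_growthQuotient (Finset.empty_subset T)).coeff_le_coeff_mul
    (nonnegCoeffs_growthQuotient hTU) (constantCoeff_growthQuotient _ _) n

/-- At `-r` the clique polynomial is evaluated at the positive number `r / (1 - r)`. -/
theorem cliqueSum_pos_of_neg {U : Finset V} {r : ℝ} (hr0 : 0 < r) (hr1 : r < 1) :
    0 < cliqueSum Γ U (-r / (1 + -r)) := by
  classical
  unfold cliqueSum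
  have h : 0 < -(-r / (1 + -r)) := by
    rw [neg_div, neg_neg]
    exact div_pos hr0 (by linarith)
  refine Finset.sum_pos (fun S _ => pow_pos h _) ⟨∅, ?_⟩
  simp

/-- Real parts are dominated term by term, so equal sums force equality in every term with `c n ≠
0`. The term `n = 2` gives `Re (z ^ 2) = r ^ 2`, which together with `‖z‖ ≤ r` makes `z` real. -/
theorem eq_of_hasSum_eq_one {c : ℕ → ℝ} (hc : ∀ n, 0 ≤ c n) (h2 : 0 < c 2) {r : ℝ} {z : ℂ}
    (hz : ‖z‖ ≤ r) (hr : HasSum (fun n => (c n : ℂ) * (r : ℂ) ^ n) 1)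
    (hs : HasSum (fun n => (c n : ℂ) * z ^ n) 1) : z = r ∨ z = -r := by
  have hr0 : 0 ≤ r := (norm_nonneg z).trans hz
  have h1 := (Complex.hasSum_re hr).sub (Complex.hasSum_re hs)
  rw [sub_self] at h1
  have hterm : ∀ n, ((c n : ℂ) * (r : ℂ) ^ n).re - ((c n : ℂ) * z ^ n).re =
      c n * (r ^ n - (z ^ n).re) := by
    intro n
    rw [Complex.re_ofReal_mul, Complex.re_ofReal_mul, ← Complex.ofReal_pow, Complex.ofReal_re]
    ring
  simp only [hterm] at h1
  have hnn : ∀ n, 0 ≤ c n * (r ^ n - (z ^ n).re) := by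
    intro n
    refine mul_nonneg (hc n) (sub_nonneg.2 ((Complex.re_le_norm _).trans ?_))
    rw [norm_pow]
    exact pow_le_pow_left₀ (norm_nonneg z) hz n
  have h3 := (hasSum_zero_iff_of_nonneg hnn).1 h1
  have h4 : r ^ 2 - (z ^ 2).re = 0 :=
    (mul_eq_zero.1 (congrFun h3 2)).resolve_left h2.ne'
  have h5 : (z ^ 2).re = z.re ^ 2 - z.im ^ 2 := by
    rw [pow_two, Complex.mul_re]
    ring
  have h6 : z.re ^ 2 + z.im ^ 2 ≤ r ^ 2 := by
    have := pow_le_pow_left₀ (norm_nonneg z) hz 2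
    rw [Complex.sq_norm, Complex.normSq_apply] at this
    linarith
  have h7 : z.im = 0 := by
    have : z.im ^ 2 = 0 := by nlinarith [sq_nonneg z.im]
    exact pow_eq_zero_iff two_ne_zero |>.1 this
  have h8 : z.re = r ∨ z.re = -r := by
    rw [h7] at h5
    exact sq_eq_sq_iff_eq_or_eq_neg.1 (by linarith)
  rcases h8 with h | h
  · left
    apply Complex.ext <;> simp [h, h7]
  · right
    apply Complex.ext <;> simp [h, h7]

/-- If `r` is the radius of convergence of the growth series, then a minimal special
subgroup whose clique sum vanishes at `r` has no further zeros in the closed disc of radius `r`. -/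
theorem exists_unique_zero_of_smallest_norm (W : Finset V) {r : ℝ} (hr0 : 0 < r) (hr1 : r < 1)
    (h : ∀ s, 0 < s → s < r → Summable fun n => coeff n (growthQuotient Γ W ∅) * s ^ n)
    (hW : cliqueSum Γ W (r / (1 + r)) = 0) :
    ∃ U : Finset V, cliqueSum Γ U (r / (1 + r)) = 0 ∧
      ∀ z : ℂ, ‖z‖ ≤ r → cliqueSum Γ U (z / (1 + z)) = 0 → z = r := by
  classical
  obtain ⟨U, hUW, hmin⟩ := exists_minimal_le_of_wellFoundedLT
    (fun U : Finset V => cliqueSum Γ U (r / (1 + r)) = 0) W hW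
  have hU0 : U.Nonempty := by
    rw [Finset.nonempty_iff_ne_empty]
    rintro rfl
    simpa [cliqueSum_empty] using hmin.prop
  obtain ⟨v, hv⟩ := hU0
  set T := U.erase v with hT
  have hvT : v ∉ T := Finset.notMem_erase v U
  have hU : insert v T = U := Finset.insert_erase hv
  have hTU : T ⊂ U := Finset.erase_ssubset hv
  have hTne : cliqueSum Γ T (r / (1 + r)) ≠ 0 := fun h0 => hmin.not_prop_of_lt hTU h0
  -- By minimality of `U`, the growth series of the group on `T` still converges at `r` itself, so
  -- its clique sum has no zero in the closed disc.
  have hTsum : Summable fun n => coeff n (growthQuotient Γ T ∅) * r ^ n :=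
    summable_of_cliqueSum_ne_zero (nonnegCoeffs_growthQuotient (Finset.empty_subset T))
      (growthQuotient_empty_mul_cliqueSum T) hr0 hr1
      (fun s hs hsr => summable_mono (nonnegCoeffs_growthQuotient (Finset.empty_subset T))
        (coeff_growthQuotient_le (Finset.empty_subset T) (hTU.le.trans hUW)) hs.le (h s hs hsr)) hTne
  have hLT : T.filter (Γ.Adj v) ⊆ T := Finset.filter_subset _ _
  have hLsum : Summable fun n => coeff n (growthQuotient Γ T (T.filter (Γ.Adj v))) * r ^ n :=
    summable_mono (nonnegCoeffs_growthQuotient hLT) (coeff_growthQuotient_le_empty hLT) hr0.le hTsum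
  have hC : ∀ z : ℂ, ‖z‖ ≤ r → cliqueSum Γ U (z / (1 + z)) = 0 →
      HasSum (fun n => ((coeff n (returnSeries Γ v T) : ℝ) : ℂ) * z ^ n) 1 := by
    intro z hz hzero
    have hz1 := hz.trans_lt hr1
    obtain ⟨b, hb⟩ := EvaluatesTo.of_summable
      (summable_norm_of_nonnegCoeffs (nonnegCoeffs_growthQuotient hLT) hLsum hz)
    have hret : EvaluatesTo (returnSeries Γ v T) z (z * (b - 1)) :=
      (EvaluatesTo.X z).mul (hb.sub (EvaluatesTo.one z))
    have hTz : cliqueSum Γ T (z / (1 + z)) ≠ 0 :=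
      cliqueSum_ne_zero (growthQuotient_empty_mul_cliqueSum T) hz1
        (summable_norm_of_nonnegCoeffs (nonnegCoeffs_growthQuotient (Finset.empty_subset T)) hTsum hz)
    have h1 := ((EvaluatesTo.one z).add (EvaluatesTo.X z)).mul
      (EvaluatesTo.cliqueSum (Γ := Γ) (insert v T) hz1)
    have h2 := (EvaluatesTo.cliqueSum (Γ := Γ) T hz1).mul ((EvaluatesTo.one z).sub hret)
    rw [one_add_X_mul_cliqueSum_insert hvT] at h1
    have h3 := h2.unique h1
    rw [hU, hzero, mul_zero] at h3
    have h4 := (mul_eq_zero.1 h3).resolve_left hTz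
    rw [sub_eq_zero.1 h4]
    exact hret.2
  have hCr := hC r (by rw [Complex.norm_real, Real.norm_of_nonneg hr0.le]) (by
    rw [← ofReal_cliqueSum, hmin.prop, Complex.ofReal_zero])
  have hC2 : 0 < coeff 2 (returnSeries Γ v T) := by
    rw [coeff_two_returnSeries, sub_pos, Nat.cast_lt]
    -- If `v` were adjacent to all of `T`, the return series would vanish and could not take the
    -- value `1` at `r`.
    refine Finset.card_lt_card (hLT.ssubset_of_ne fun heq => ?_)
    have h0 : returnSeries Γ v T = 0 := by
      rw [returnSeries, heq, growthQuotient_self, sub_self, mul_zero]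
    rw [h0] at hCr
    simp only [map_zero, Complex.ofReal_zero, zero_mul] at hCr
    exact one_ne_zero (hCr.unique hasSum_zero)
  refine ⟨U, hmin.prop, fun z hz hzero => ?_⟩
  rcases eq_of_hasSum_eq_one (nonnegCoeffs_returnSeries v T) hC2 hz hCr (hC z hz hzero) with hz' | hz'
  · exact hz'
  · have hpos := cliqueSum_pos_of_neg (Γ := Γ) (U := U) hr0 hr1
    have h1 := ofReal_cliqueSum (Γ := Γ) U (-r)
    rw [Complex.ofReal_neg, ← hz', hzero, Complex.ofReal_eq_zero] at h1
    exact absurd h1 hpos.ne'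

/-! ### The integer polynomial and the Perron property -/

open Polynomial in
open Classical in
variable (Γ) in
/-- The monic integer polynomial `z ^ n * F(1 / z)`, where `n` is the number of vertices in `U`
and `F(t)` is the clique sum at `t / (1 + t)`, multiplied by `((1 + z) / z) ^ n`. -/
noncomputable def growthPolynomial (U : Finset V) : ℤ[X] :=
  ∑ S ∈ U.powerset.filter fun S : Finset V => Γ.IsClique (S : Set V),
    (-1) ^ S.card * (Polynomial.X + 1) ^ (U.card - S.card)

/-- The empty clique contributes `(X + 1) ^ U.card`; every other clique contributes a term of
smaller degree. -/
theorem monic_growthPolynomial (U : Finset V) : (growthPolynomial Γ U).Monic := by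
  classical
  have hmem : ∅ ∈ U.powerset.filter fun S : Finset V => Γ.IsClique (S : Set V) := by simp
  rw [growthPolynomial, ← Finset.add_sum_erase _ _ hmem]
  have hmonic : (Polynomial.X + 1 : Polynomial ℤ).Monic := Polynomial.monic_X_add_C 1
  have hdeg : ∀ k : ℕ, ((Polynomial.X + 1 : Polynomial ℤ) ^ k).degree = k := by
    intro k
    rw [Polynomial.degree_pow, ← Polynomial.C_1, Polynomial.degree_X_add_C]
    simp
  simp only [Finset.card_empty, pow_zero, one_mul, Nat.sub_zero]
  refine (hmonic.pow _).add_of_left ((Polynomial.degree_sum_le _ _).trans_lt ?_)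
  rw [hdeg, Finset.sup_lt_iff (WithBot.bot_lt_coe _)]
  intro S hS
  obtain ⟨hS0, hSU⟩ := Finset.mem_erase.1 hS
  have hle := Finset.card_le_card (Finset.mem_powerset.1 (Finset.mem_filter.1 hSU).1)
  have hpos := Finset.card_pos.2 (Finset.nonempty_iff_ne_empty.2 hS0)
  have hsign : ((-1 : Polynomial ℤ) ^ S.card).degree = 0 := by
    rw [Polynomial.degree_pow, Polynomial.degree_neg, Polynomial.degree_one, smul_zero]
  rw [Polynomial.degree_mul, hsign, hdeg, zero_add, Nat.cast_lt]
  omega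

theorem aeval_growthPolynomial {U : Finset V} {z : ℂ} (hz : 1 + z ≠ 0) :
    Polynomial.aeval z (growthPolynomial Γ U) = (1 + z) ^ U.card * cliqueSum Γ U (1 / (1 + z)) := by
  classical
  rw [growthPolynomial, cliqueSum, map_sum, Finset.mul_sum]
  refine Finset.sum_congr rfl fun S hS => ?_
  have hle : S.card ≤ U.card :=
    Finset.card_le_card (Finset.mem_powerset.1 (Finset.mem_filter.1 hS).1)
  simp only [map_mul, map_pow, map_neg, map_one, map_add, Polynomial.aeval_X]
  rw [add_comm z 1, pow_sub₀ _ hz hle, ← neg_div, div_pow]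
  field_simp

/-- Every conjugate `z` of `r⁻¹` is a root of the growth polynomial. If `‖z‖ ≥ r⁻¹`, then `z⁻¹` is a
zero of the clique sum in the closed disc of radius `r`, hence equals `r`. -/
theorem isPerronNumber_inv {U : Finset V} {r : ℝ} (hr0 : 0 < r) (hr1 : r < 1)
    (hU : cliqueSum Γ U (r / (1 + r)) = 0)
    (huniq : ∀ z : ℂ, ‖z‖ ≤ r → cliqueSum Γ U (z / (1 + z)) = 0 → z = r) :
    IsPerronNumber r⁻¹ := by
  have hroot : Polynomial.aeval (((r⁻¹ : ℝ)) : ℂ) (growthPolynomial Γ U) = 0 := by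
    have h0 : (1 + r : ℝ) ≠ 0 := by positivity
    have h1 : (1 : ℂ) + ((r⁻¹ : ℝ) : ℂ) ≠ 0 := by
      exact_mod_cast (by positivity : (1 + r⁻¹ : ℝ) ≠ 0)
    have h2 : (1 : ℝ) / (1 + r⁻¹) = r / (1 + r) := by
      field_simp
      ring
    have h3 : (1 : ℂ) / (1 + ((r⁻¹ : ℝ) : ℂ)) = ((r / (1 + r) : ℝ) : ℂ) := by
      rw [← h2]
      push_cast
      rfl
    have h4 := map_cliqueSum (Γ := Γ) Complex.ofRealHom U (r / (1 + r))
    rw [hU, map_zero] at h4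
    rw [aeval_growthPolynomial h1, h3]
    exact mul_eq_zero_of_right _ h4.symm
  have hint : IsIntegral ℤ (((r⁻¹ : ℝ)) : ℂ) :=
    ⟨growthPolynomial Γ U, monic_growthPolynomial U, by rwa [← Polynomial.aeval_def]⟩
  refine ⟨?_, (one_lt_inv₀ hr0).2 hr1, fun z hconj hne => ?_⟩
  · exact (isIntegral_algHom_iff (Complex.ofRealAm.restrictScalars ℤ) Complex.ofReal_injective).1 hint
  · by_contra! hlt
    have hz : Polynomial.aeval z (growthPolynomial Γ U) = 0 := by
      have hdvd : minpoly ℚ (((r⁻¹ : ℝ)) : ℂ) ∣ (growthPolynomial Γ U).map (Int.castRingHom ℚ) := by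
        refine minpoly.dvd ℚ _ ?_
        rw [← hroot]
        exact Polynomial.aeval_map_algebraMap ℚ _ _
      rw [IsConjRoot] at hconj
      rw [hconj] at hdvd
      obtain ⟨q, hq⟩ := hdvd
      have h1 := congrArg (Polynomial.aeval z) hq
      rw [map_mul, minpoly.aeval, zero_mul] at h1
      rw [← h1]
      exact (Polynomial.aeval_map_algebraMap ℚ _ _).symm
    have hrinv : 1 < r⁻¹ := (one_lt_inv₀ hr0).2 hr1
    have hz0 : z ≠ 0 := by
      rintro rfl
      rw [norm_zero] at hlt
      linarith
    have hz1 : 1 + z ≠ 0 := by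
      intro h0
      rw [eq_neg_of_add_eq_zero_right h0, norm_neg, norm_one] at hlt
      linarith
    rw [aeval_growthPolynomial hz1] at hz
    have h2 := (mul_eq_zero.1 hz).resolve_left (pow_ne_zero _ hz1)
    have h3 : (1 : ℂ) / (1 + z) = z⁻¹ / (1 + z⁻¹) := by
      have : 1 + z⁻¹ ≠ 0 := by
        intro h0
        apply hz1
        field_simp at h0
        linear_combination h0
      rw [div_eq_div_iff hz1 this, one_mul, mul_add, mul_one, inv_mul_cancel₀ hz0, add_comm]
    rw [h3] at h2
    have h4 := huniq z⁻¹ (by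
      rw [norm_inv]
      exact inv_le_of_inv_le₀ hr0 hlt) h2
    apply hne
    rw [Complex.ofReal_inv, ← h4, inv_inv]

/-! ### The root test and the conclusion -/

section RootTest

variable {a : ℕ → ℝ}

theorem summable_of_limsup_lt (ha : ∀ n, 0 ≤ a n)
    (hb : BddAbove (Set.range fun n : ℕ => a n ^ (1 / (n : ℝ)))) {r : ℝ} (hr : 0 < r)
    (h : limsup (fun n : ℕ => a n ^ (1 / (n : ℝ))) atTop < r⁻¹) :
    Summable fun n => a n * r ^ n := by
  obtain ⟨s, hs1, hs2⟩ := exists_between h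
  have hev := eventually_lt_of_limsup_lt hs1 (hb.isBoundedUnder_of_range)
  have hs0 : 0 < s := by
    obtain ⟨n, hn⟩ := hev.exists
    exact (Real.rpow_nonneg (ha n) _).trans_lt hn
  have hsr : s * r < 1 := by
    rwa [lt_inv_comm₀ hs0 hr, ← one_div, lt_div_iff₀' hs0] at hs2
  refine Summable.of_norm_bounded_eventually_nat
    (summable_geometric_of_lt_one (mul_pos hs0 hr).le hsr) ?_
  -- The index `0` is discarded, since there the exponent `1 / n` has the default value `0`.
  filter_upwards [hev, eventually_gt_atTop 0] with n hn hn0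
  rw [Real.norm_of_nonneg (mul_nonneg (ha n) (pow_nonneg hr.le n)), mul_pow]
  refine mul_le_mul_of_nonneg_right ?_ (pow_nonneg hr.le n)
  have := pow_le_pow_left₀ (Real.rpow_nonneg (ha n) _) hn.le n
  rwa [one_div, Real.rpow_inv_natCast_pow (ha n) hn0.ne'] at this

theorem limsup_le_of_summable (ha : ∀ n, 0 ≤ a n) {r : ℝ} (hr : 0 < r)
    (h : Summable fun n => a n * r ^ n) :
    limsup (fun n : ℕ => a n ^ (1 / (n : ℝ))) atTop ≤ r⁻¹ := by
  refine limsup_le_of_le ⟨0, ?_⟩ ?_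
  · intro b hb
    rw [eventually_map] at hb
    obtain ⟨n, hn⟩ := hb.exists
    exact (Real.rpow_nonneg (ha n) _).trans hn
  · filter_upwards [h.tendsto_atTop_zero.eventually_le_const one_pos, eventually_gt_atTop 0]
      with n hn hn0
    have h1 : a n ≤ (r⁻¹) ^ n := by
      rw [inv_pow, ← one_div, le_div_iff₀ (pow_pos hr n)]
      exact hn
    have h2 := Real.rpow_le_rpow (ha n) h1 (by positivity : (0 : ℝ) ≤ 1 / (n : ℝ))
    rw [one_div, Real.pow_rpow_inv_natCast (inv_pos.2 hr).le hn0.ne'] at h2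
    rwa [one_div]

end RootTest

/-- A non-empty sphere has at least one element, so a rate below `1` would make all large spheres
empty and the group a finite union of finite spheres. -/
theorem one_le_sphericalGrowthRate [Finite V] [Infinite (RACG Γ)] :
    1 ≤ sphericalGrowthRate (racgGenerators Γ) := by
  refine le_limsup_of_frequently_le ?_
    (sphericalGrowthRate_bounded (Set.finite_range _)).isBoundedUnder_of_range
  by_contra hne
  rw [not_frequently, eventually_atTop] at hne
  obtain ⟨N, hN⟩ := hne
  have hempty : ∀ l ≥ N, (wordSphere (racgGenerators Γ) l).ncard = 0 := by
    intro l hl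
    by_contra h0
    apply hN l hl
    exact Real.one_le_rpow (by exact_mod_cast Nat.one_le_iff_ne_zero.2 h0) (by positivity)
  have huniv : (Set.univ : Set (RACG Γ)) ⊆ ⋃ l ∈ Set.Iio N, {g | len g = l} := by
    intro g _
    simp only [Set.mem_iUnion]
    refine ⟨len g, ?_, rfl⟩
    by_contra hg
    have h1 := hempty (len g) (by simpa using hg)
    rw [wordSphere_eq, Set.ncard_eq_zero (finite_len_eq _)] at h1
    exact Set.eq_empty_iff_forall_notMem.1 h1 g rfl
  exact Set.infinite_univ (((Set.finite_Iio N).biUnion fun l _ => finite_len_eq l).subset huniv)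

end RACG

theorem theoremA {V : Type*} [Finite V] (Γ : SimpleGraph V) (hG : Infinite (RACG Γ)) :
    sphericalGrowthRate (racgGenerators Γ) = 1 ∨
      IsPerronNumber (sphericalGrowthRate (racgGenerators Γ)) := by
  have := Fintype.ofFinite V
  refine RACG.one_le_sphericalGrowthRate.eq_or_lt.imp Eq.symm fun hlt => ?_
  set α := sphericalGrowthRate (racgGenerators Γ) with hα
  have hα0 : 0 < α := one_pos.trans hlt
  have ha : ∀ l, (0 : ℝ) ≤ (wordSphere (racgGenerators Γ) l).ncard := fun l => Nat.cast_nonneg _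
  have hW : RACG.growthQuotient Γ Finset.univ ∅ = RACG.growthSeries Γ := by
    have h1 := RACG.inv_cliqueSum_mul_cliqueSum (Γ := Γ) Finset.univ
    have h2 := RACG.growthSeries_mul_cliqueSum (Γ := Γ)
    rw [RACG.growthQuotient, RACG.cliqueSum_empty, mul_one]
    exact mul_right_cancel₀ (right_ne_zero_of_mul (h1 ▸ one_ne_zero)) (h1.trans h2.symm)
  have hcoeff : ∀ n, PowerSeries.coeff n (RACG.growthQuotient Γ Finset.univ ∅) =
      (wordSphere (racgGenerators Γ) n).ncard := by
    intro n
    rw [hW, RACG.growthSeries, PowerSeries.coeff_mk]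
  -- The radius of convergence is `α⁻¹`. That it is below `1` keeps the closed disc away from the
  -- pole of `t / (1 + t)` at `-1`.
  have hr0 : 0 < α⁻¹ := inv_pos.2 hα0
  have hr1 : α⁻¹ < 1 := inv_lt_one_of_one_lt₀ hlt
  have hconv : ∀ s, 0 < s → s < α⁻¹ →
      Summable fun n => PowerSeries.coeff n (RACG.growthQuotient Γ Finset.univ ∅) * s ^ n := by
    intro s hs hsr
    simp only [hcoeff]
    exact RACG.summable_of_limsup_lt ha (sphericalGrowthRate_bounded (Set.finite_range _)) hs
      ((lt_inv_comm₀ hs hα0).1 hsr)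
  have hdiv : ∀ s, α⁻¹ < s →
      ¬ Summable fun n => PowerSeries.coeff n (RACG.growthQuotient Γ Finset.univ ∅) * s ^ n := by
    intro s hsr hsum
    simp only [hcoeff] at hsum
    have h1 : α ≤ s⁻¹ := RACG.limsup_le_of_summable ha (hr0.trans hsr) hsum
    exact absurd h1 (not_le.2 ((inv_lt_comm₀ hα0 (hr0.trans hsr)).1 hsr))
  have hzero := RACG.cliqueSum_eq_zero_of_radius
    (RACG.nonnegCoeffs_growthQuotient (Finset.empty_subset _))
    (RACG.growthQuotient_empty_mul_cliqueSum (Γ := Γ) Finset.univ) hr0 hr1 hconv hdiv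
  obtain ⟨U, hU, huniq⟩ :=
    RACG.exists_unique_zero_of_smallest_norm (Γ := Γ) Finset.univ hr0 hr1 hconv hzero
  have := RACG.isPerronNumber_inv hr0 hr1 hU huniq
  rwa [inv_inv] at this
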